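/- An uncertain point with $k \ge 1$ possible locations in $\mathbb{R}$ is a tuple $p_i = (p_{i,1},\dots,p_{i,k})$ of real numbers (not necessarily distinct), whose location is $p_{i,j}$ with probability $1/k$ for each $j$. For a nonempty finite family $P = (p_1,\dots,p_n)$ of such points let $Q = (q_1,\dots,q_n)$ be a random transversal: the $q_i$ are independent and $q_i$ has the distribution of $p_i$. For $r \subseteq \mathbb{R}$ and $\tau \in [0,1]$ put $$G_{P,r}(\tau) = \frac{1}{|P|}\,\bigl|\{\, p_i \in P : \Pr_Q[q_i \in r] \ge \tau \,\}\bigr| .$$ Let $\mathcal{I}_+$ be the family of the one-sided intervals $(-\infty,a]$, $a \in \mathbb{R}$. A nonempty $T \subseteq P$ is an $\varepsilon$-RC coreset of $(P,\mathcal{I}_+)$ if $|G_{P,r}(\tau) - G_{T,r}(\tau)| \le \varepsilon$ for all $r \in \mathcal{I}_+$ and all $\tau \in [0,1]$. Theorem. There is an absolute constant $C > 0$ such that for all $k, n \ge 1$, every family $P$ of $n$ uncertain points in $\mathbb{R}$ with $k$ possible locations each, and every $0 < \varepsilon \le 1$, there is an $\varepsilon$-RC coreset $T \subseteq P$ of $(P,\mathcal{I}_+)$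 with $$|T| \le \max\Bigl\{1,\; C\,\frac{\sqrt{k}}{\varepsilon}\,\log\frac{k}{\varepsilon}\Bigr\}.$$ Moreover, for every $p_i \in P$, every $t \in \{1,\dots,k\}$ and every $a \in \mathbb{R}$, one has $\Pr_Q[q_i \in (-\infty,a]] \ge t/k$ if and only if the $t$-th smallest location of $p_i$ (counted with multiplicity) lies in $(-\infty,a]$. -/

import Mathlib

open MeasureTheory
open scoped ENNReal

namespace Uncertain

variable {E : Type*} [MeasurableSpace E]

/-- An uncertain point with `k` possible locations is given by its tuple of locations
`p : Fin k → E`.  Its law gives probability `1 / k` to each of the `k` locations. -/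
noncomputable def law {k : ℕ} (p : Fin k → E) : Measure E :=
  ∑ j : Fin k, (k : ℝ≥0∞)⁻¹ • Measure.dirac (p j)

/-- The law of a random transversal `Q = (q_i)` of the family `P = (p_i)` of uncertain points:
the locations `q_i` are independent, and `q_i` is distributed according to `p_i`. -/
noncomputable def transversalMeasure {ι : Type*} [Fintype ι] {k : ℕ} (P : ι → Fin k → E) :
    Measure (ι → E) :=
  Measure.pi fun i => law (P i)

/-- The probability `Pr [q_i ∈ r]` over a random transversal `Q` of `P`. -/
noncomputable def inclusionProb {ι : Type*} [Fintype ι] {k : ℕ} (P : ι → Fin k → E)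
    (r : Set E) (i : ι) : ℝ :=
  (transversalMeasure P).real {Q | Q i ∈ r}

/-- `G_{P,r}(τ)`: the fraction of the uncertain points of `P` that lie in the range `r` with
probability at least `τ`. -/
noncomputable def rangeCount {ι : Type*} [Fintype ι] {k : ℕ} (P : ι → Fin k → E)
    (r : Set E) (τ : ℝ) : ℝ :=
  ({i : ι | τ ≤ inclusionProb P r i}.ncard : ℝ) / (Fintype.card ι : ℝ)

/-- The nonempty subset `T` of the uncertain points of `P` is an `ε`-RC coreset of `P` for the
family `A` of ranges. -/
def IsRCCoreset {ι : Type*} [Fintype ι] {k : ℕ} (ε : ℝ) (P : ι → Fin k → E)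
    (A : Set (Set E)) (T : Finset ι) : Prop :=
  T.Nonempty ∧ ∀ r ∈ A, ∀ τ ∈ Set.Icc (0 : ℝ) 1,
    |rangeCount P r τ - rangeCount (fun i : {i : ι // i ∈ T} => P i) r τ| ≤ ε

/-- The one-sided intervals `(-∞, a]` of the real line. -/
def oneSidedIntervals : Set (Set ℝ) :=
  {r | ∃ a : ℝ, r = Set.Iic a}

/-- `kthSmallest p j` is the location of `p` with (zero-based) index `j` when the `k` locations
are sorted increasingly, counted with multiplicity. -/
noncomputable def kthSmallest {k : ℕ} (p : Fin k → ℝ) (j : Fin k) : ℝ :=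
  p (Tuple.sort p j)

end Uncertain

/-!
For a half-line `r = (-∞, a]`, the probability that `q_i` lies in `r` is the number of locations of
`p_i` in `r` divided by `k`. Hence it is at least `τ > 0` if and only if the `⌈τ k⌉`-th smallest
location of `p_i` is at most `a` (`div_le_inclusionProb_iff`, `exists_le_inclusionProb_iff`), and a
coreset is a subset that approximates all sublevel sets of the `k` functions `kthSmallest · j` at
once (`isRCCoreset_of_lowFrac`).

Such a subset comes from discrepancy theory. The sublevel sets of one function are prefixes of a
linear arrangement of the points, so a colouring by `±1` is needed under which all prefixes of `k`
arrangements are nearly balanced.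

* Partial colouring (`exists_far_pair_of_chains`, `exists_partial_coloring`). Record for each
  colouring a vector of rounded sums: prefix sums at multiples of `L` (a power of two between
  `9000 k` and `18000 k`), rounded to multiples of `√L`, and sums over aligned blocks of length
  `L / 2 ^ h`, rounded to multiples of `√L * (19 / 20) ^ h`. With the former encoded through their
  increments, a fourth moment bound shows that this vector has a code of mean length at most
  `n / 10`. So many colourings share one vector (`exists_large_fiber`), and two of them differ in
  at least `n / 10` points (`exists_far_pair`). Half their difference is a partial colouring with
  discrepancy `O(√k)`, because every prefix splits into a recorded prefix and at most one block of
  each length.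
* Iterating on the uncoloured points gives discrepancy `O(√k log n)` (`exists_coloring`).
* A colour class of such a colouring approximates the whole set up to `O(√k log n / n)`
  (`exists_half`). Repeated halving down to `M` points sums these errors to `O(√k log M / M)`
  (`exists_subset_of_coloring`), which is at most `ε` for `M = C √k / ε * log (k / ε)`.

The last estimate needs `log (k / ε)` bounded away from `0`. Otherwise `k = 1` and `ε > 1 / 2`, and
a median is a coreset (`exists_median`).
-/

namespace Uncertain

/-! ### Large fibres of integer-valued codes -/

/-- The weights `r ^ |z|` on the integers have total mass at most `exp (2 r / (1 - r))`; this is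
the Kraft inequality for the code of lengths `|z| * log (1 / r) + 2 * r / (1 - r)`. -/
lemma sum_pow_natAbs_le_exp {r : ℝ} (h0 : 0 < r) (h1 : r < 1) (Z : Finset ℤ) :
    ∑ z ∈ Z, r ^ z.natAbs ≤ Real.exp (2 * r / (1 - r)) := by
  have hs := hasSum_geometric_of_lt_one h0.le h1
  have hs' : HasSum (fun n : ℕ => r ^ (n + 1)) ((1 - r)⁻¹ * r) := by
    simpa [pow_succ] using hs.mul_right r
  have hint : HasSum (fun z : ℤ => r ^ z.natAbs) ((1 - r)⁻¹ + (1 - r)⁻¹ * r) := by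
    refine HasSum.of_nat_of_neg_add_one (f := fun z : ℤ => r ^ z.natAbs) ?_ ?_
    · simpa using hs
    · have h : ∀ n : ℕ, (-((n : ℤ) + 1)).natAbs = n + 1 := fun n => by omega
      simpa only [h] using hs'
  have hle := sum_le_hasSum Z (fun z _ => by positivity) hint
  have h2 : (1 - r)⁻¹ + (1 - r)⁻¹ * r = 2 * r / (1 - r) + 1 := by
    have : 1 - r ≠ 0 := by linarith
    field_simp
    ring
  exact (hle.trans h2.le).trans (Real.add_one_le_exp _)

/-- If the values `g x α` of an integer-valued map on a finite space are encoded, coordinate by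
coordinate, by codes `c α` satisfying the Kraft inequality, and the mean total code length is at
most `R`, then some fibre of `g` has at least the proportion `exp (-R)` of all points. -/
lemma exists_large_fiber {Ω A : Type*} [Fintype Ω] [Nonempty Ω] [Fintype A]
    (g : Ω → A → ℤ) (c : A → ℤ → ℝ)
    (hc : ∀ α (Z : Finset ℤ), ∑ z ∈ Z, Real.exp (-c α z) ≤ 1) {R : ℝ}
    (hR : ∑ x, ∑ α, c α (g x α) ≤ Fintype.card Ω * R) :
    ∃ b : A → ℤ, Fintype.card Ω * Real.exp (-R) ≤ ((Finset.univ.filter (g · = b)).card : ℝ) := by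
  classical
  by_contra! hcon
  set q : (A → ℤ) → ℝ := fun b => ∏ α, Real.exp (-c α (b α)) with hq
  have hq0 : ∀ b, 0 < q b := fun b => Finset.prod_pos fun α _ => Real.exp_pos _
  set B := Finset.univ.image g with hB
  have hBne : B.Nonempty := Finset.univ_nonempty.image g
  have hsub : B ⊆ Fintype.piFinset fun α => B.image (· α) := by
    intro b hb
    exact Fintype.mem_piFinset.2 fun α => Finset.mem_image_of_mem _ hb
  have hmass : ∑ b ∈ B, q b ≤ 1 := by
    refine (Finset.sum_le_sum_of_subset_of_nonneg hsub fun b _ _ => (hq0 b).le).trans ?_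
    rw [hq, ← Finset.prod_univ_sum (fun α => B.image (· α)) fun α z => Real.exp (-c α z)]
    exact Finset.prod_le_one (fun α _ => Finset.sum_nonneg fun z _ => (Real.exp_pos _).le)
      fun α _ => hc α _
  have hN : (0 : ℝ) < Fintype.card Ω := by exact_mod_cast Fintype.card_pos
  have hup : ∑ x, q (g x) < Fintype.card Ω * Real.exp (-R) := by
    calc ∑ x, q (g x) = ∑ b ∈ B, ∑ x with g x = b, q (g x) :=
          (Finset.sum_fiberwise_of_maps_to (fun x _ => Finset.mem_image_of_mem g (Finset.mem_univ x))
            _).symm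
      _ = ∑ b ∈ B, ((Finset.univ.filter (g · = b)).card : ℝ) * q b := by
          refine Finset.sum_congr rfl fun b _ => ?_
          rw [Finset.sum_congr rfl (g := fun _ => q b)]
          · simp
          · intro x hx
            rw [(Finset.mem_filter.1 hx).2]
      _ < ∑ b ∈ B, (Fintype.card Ω * Real.exp (-R)) * q b :=
          Finset.sum_lt_sum_of_nonempty hBne fun b _ =>
            mul_lt_mul_of_pos_right (hcon b) (hq0 b)
      _ = (Fintype.card Ω * Real.exp (-R)) * ∑ b ∈ B, q b := by rw [Finset.mul_sum]
      _ ≤ _ := mul_le_of_le_one_right (by positivity) hmass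
  -- the tangent line of `exp` at `-R` gives the matching lower bound
  have hlow : ∀ x, Real.exp (-R) * (R - ∑ α, c α (g x α) + 1) ≤ q (g x) := by
    intro x
    have h1 : q (g x) = Real.exp (-R) * Real.exp (R - ∑ α, c α (g x α)) := by
      rw [← Real.exp_add, hq]
      simp only
      rw [← Real.exp_sum, Finset.sum_neg_distrib]
      congr 1
      ring
    rw [h1]
    exact mul_le_mul_of_nonneg_left (Real.add_one_le_exp _) (Real.exp_pos _).le
  have hsum := Finset.sum_le_sum fun x (_ : x ∈ Finset.univ) => hlow x
  rw [← Finset.mul_sum, Finset.sum_add_distrib, Finset.sum_sub_distrib] at hsum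
  simp only [Finset.sum_const, Finset.card_univ, nsmul_eq_mul, mul_one] at hsum
  have := mul_le_mul_of_nonneg_left
    (show (Fintype.card Ω : ℝ) ≤ Fintype.card Ω * R - ∑ x, ∑ α, c α (g x α) + Fintype.card Ω by
      linarith) (Real.exp_pos (-R)).le
  linarith

/-- A set of at least `2 ^ n * exp (-n / 10)` points of the `n`-dimensional cube contains two
points that differ in at least `n / 10` coordinates, since a Hamming ball of radius less than
`n / 10` has fewer points. -/
lemma exists_far_pair {ι : Type*} [Fintype ι] (F : Finset (ι → Bool))
    (hn : 0 < Fintype.card ι)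
    (hF : 2 ^ Fintype.card ι * Real.exp (-((Fintype.card ι : ℝ) / 10)) ≤ (F.card : ℝ)) :
    ∃ x ∈ F, ∃ x' ∈ F,
      Fintype.card ι ≤ 10 * (Finset.univ.filter fun v => x v ≠ x' v).card := by
  classical
  set n := Fintype.card ι with hndef
  have hFpos : 0 < F.card := by
    have : (0 : ℝ) < F.card := lt_of_lt_of_le (by positivity) hF
    exact_mod_cast this
  obtain ⟨x, hx⟩ := Finset.card_pos.1 hFpos
  by_contra! hcon
  have hball := fun x' hx' => hcon x hx x' hx'
  set d : (ι → Bool) → Finset ι := fun x' => Finset.univ.filter fun v => x v ≠ x' v with hd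
  have hinj : Set.InjOn d F := by
    intro y _ z _ hyz
    funext v
    have h : (x v ≠ y v) ↔ (x v ≠ z v) := by
      have := congrArg (v ∈ ·) hyz
      simpa [hd] using this
    revert h
    cases x v <;> cases y v <;> cases z v <;> simp
  -- weigh a difference set `D` with `(1 / 2) ^ |D|`; the total weight is `(3 / 2) ^ n`
  have htot : ∑ D : Finset ι, (1 / 2 : ℝ) ^ D.card = (3 / 2) ^ n := by
    have := Fintype.sum_pow_mul_eq_add_pow ι (1 / 2 : ℝ) 1
    simp only [one_pow, mul_one] at this
    rw [this, ← hndef]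
    norm_num
  have hw : ∀ x' ∈ F, Real.exp (-((n : ℝ) / 10)) ≤ (1 / 2 : ℝ) ^ (d x').card := by
    intro x' hx'
    have h10 : (10 : ℝ) * (d x').card ≤ n := by exact_mod_cast (hball x' hx').le
    have : Real.exp (-((d x').card : ℝ)) ≤ (1 / 2 : ℝ) ^ (d x').card := by
      rw [show -((d x').card : ℝ) = (d x').card * (-1 : ℝ) by ring, Real.exp_nat_mul]
      refine pow_le_pow_left₀ (Real.exp_pos _).le ?_ _
      have := Real.exp_neg_one_lt_half
      linarith
    refine le_trans (Real.exp_le_exp.2 ?_) this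
    linarith
  have h1 : (F.card : ℝ) * Real.exp (-((n : ℝ) / 10)) ≤ (3 / 2) ^ n := by
    calc (F.card : ℝ) * Real.exp (-((n : ℝ) / 10))
        = ∑ _x' ∈ F, Real.exp (-((n : ℝ) / 10)) := by simp
      _ ≤ ∑ x' ∈ F, (1 / 2 : ℝ) ^ (d x').card := Finset.sum_le_sum hw
      _ = ∑ D ∈ F.image d, (1 / 2 : ℝ) ^ D.card := by
          rw [Finset.sum_image hinj]
      _ ≤ ∑ D : Finset ι, (1 / 2 : ℝ) ^ D.card :=
          Finset.sum_le_sum_of_subset_of_nonneg (Finset.subset_univ _) fun _ _ _ => by positivity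
      _ = _ := htot
  have h2 : (2 : ℝ) ^ n * Real.exp (-((n : ℝ) / 10)) * Real.exp (-((n : ℝ) / 10)) ≤ (3 / 2) ^ n :=
    (mul_le_mul_of_nonneg_right hF (Real.exp_pos _).le).trans h1
  have h3 : (2 : ℝ) ^ n * Real.exp (-((n : ℝ) / 10)) * Real.exp (-((n : ℝ) / 10))
      = (2 * Real.exp (-(1 / 5))) ^ n := by
    rw [mul_assoc, ← Real.exp_add, mul_pow, ← Real.exp_nat_mul]
    congr 2
    ring
  have h4 : (3 / 2 : ℝ) < 2 * Real.exp (-(1 / 5)) := by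
    have := Real.add_one_le_exp (-(1 / 5) : ℝ)
    linarith
  rw [h3] at h2
  exact absurd h2 (not_le.2 (pow_lt_pow_left₀ h4 (by norm_num) hn.ne'))

/-! ### Moments of sums of random signs -/

/-- The sign `±1` encoded by a Boolean. -/
def sgn (b : Bool) : ℝ := if b then 1 else -1

lemma sgn_not (b : Bool) : sgn (!b) = -sgn b := by cases b <;> simp [sgn]

lemma sgn_sq (b : Bool) : sgn b ^ 2 = 1 := by cases b <;> simp [sgn]

/-- Averaging over the sign of a fresh coordinate `a`. -/
lemma sum_signs_insert {ι : Type*} [Fintype ι] [DecidableEq ι] {a : ι} {S : Finset ι}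
    (ha : a ∉ S) (φ : ℝ → ℝ) :
    ∑ x : ι → Bool, φ (∑ v ∈ insert a S, sgn (x v)) =
      ∑ x : ι → Bool, φ (∑ v ∈ S, sgn (x v) - sgn (x a)) := by
  have hinv : Function.Involutive fun x : ι → Bool => Function.update x a (!x a) := by
    intro x
    simp
  refine Fintype.sum_equiv (Function.Involutive.toPerm _ hinv) _ _ fun x => ?_
  simp only [Function.Involutive.coe_toPerm]
  rw [Finset.sum_insert ha]
  congr 1
  have h : ∑ v ∈ S, sgn (Function.update x a (!x a) v) = ∑ v ∈ S, sgn (x v) := by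
    refine Finset.sum_congr rfl fun v hv => ?_
    have : v ≠ a := fun h => ha (h ▸ hv)
    simp [Function.update_of_ne this]
  rw [h]
  simp [sgn_not]
  ring

lemma sum_signs_sq {ι : Type*} [Fintype ι] [DecidableEq ι] (S : Finset ι) :
    ∑ x : ι → Bool, (∑ v ∈ S, sgn (x v)) ^ 2 = 2 ^ Fintype.card ι * S.card := by
  induction S using Finset.induction_on with
  | empty => simp
  | insert a S ha ih =>
    have h1 := sum_signs_insert ha (· ^ 2)
    have h2 : ∑ x : ι → Bool, (∑ v ∈ insert a S, sgn (x v)) ^ 2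
        + ∑ x : ι → Bool, (∑ v ∈ S, sgn (x v) - sgn (x a)) ^ 2
        = 2 * ∑ x : ι → Bool, ((∑ v ∈ S, sgn (x v)) ^ 2 + 1) := by
      rw [← Finset.sum_add_distrib, Finset.mul_sum]
      refine Finset.sum_congr rfl fun x _ => ?_
      rw [Finset.sum_insert ha]
      linear_combination 2 * sgn_sq (x a)
    rw [Finset.sum_add_distrib, ih] at h2
    simp only [Finset.sum_const, Finset.card_univ, Fintype.card_fun, Fintype.card_bool,
      nsmul_eq_mul, mul_one] at h1 h2
    rw [Finset.card_insert_of_notMem ha]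
    push_cast at h2 ⊢
    linarith

lemma sum_signs_pow_four_le {ι : Type*} [Fintype ι] [DecidableEq ι] (S : Finset ι) :
    ∑ x : ι → Bool, (∑ v ∈ S, sgn (x v)) ^ 4 ≤ 2 ^ Fintype.card ι * (3 * (S.card : ℝ) ^ 2) := by
  induction S using Finset.induction_on with
  | empty => simp
  | insert a S ha ih =>
    have h1 := sum_signs_insert ha (· ^ 4)
    have h2 : ∑ x : ι → Bool, (∑ v ∈ insert a S, sgn (x v)) ^ 4
        + ∑ x : ι → Bool, (∑ v ∈ S, sgn (x v) - sgn (x a)) ^ 4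
        = 2 * ∑ x : ι → Bool,
          ((∑ v ∈ S, sgn (x v)) ^ 4 + 6 * (∑ v ∈ S, sgn (x v)) ^ 2 + 1) := by
      rw [← Finset.sum_add_distrib, Finset.mul_sum]
      refine Finset.sum_congr rfl fun x _ => ?_
      rw [Finset.sum_insert ha]
      linear_combination
        (12 * (∑ v ∈ S, sgn (x v)) ^ 2 + 2 * (sgn (x a) ^ 2 + 1)) * sgn_sq (x a)
    rw [Finset.sum_add_distrib, Finset.sum_add_distrib, ← Finset.mul_sum, sum_signs_sq] at h2
    simp only [Finset.sum_const, Finset.card_univ, Fintype.card_fun, Fintype.card_bool,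
      nsmul_eq_mul, mul_one] at h1 h2
    rw [Finset.card_insert_of_notMem ha]
    push_cast at h2 ⊢
    have hN : (0 : ℝ) < 2 ^ Fintype.card ι := by positivity
    nlinarith

/-! ### Prefixes of linear arrangements -/

/-- Every family of sublevel sets of a function on a finite set is part of a full chain
`c 0 ⊂ c 1 ⊂ ...` of subsets, one of each cardinality. -/
lemma exists_chain {ι : Type*} [DecidableEq ι] (f : ι → ℝ) (V : Finset ι) :
    ∃ c : ℕ → Finset ι, c 0 = ∅ ∧ Monotone c ∧ (∀ m, c m ⊆ V) ∧
      (∀ m ≤ V.card, (c m).card = m) ∧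
      ∀ a, ∃ m ≤ V.card, V.filter (fun v => f v ≤ a) = c m := by
  induction V using Finset.induction_on_max_value f with
  | empty => exact ⟨fun _ => ∅, rfl, fun _ _ _ => le_rfl, by simp, by simp, by simp⟩
  | insert u s hu hmax ih =>
    obtain ⟨c, h0, hmono, hsub, hcard, hlev⟩ := ih
    refine ⟨fun m => if m ≤ s.card then c m else insert u s, by simp [h0], ?_, ?_, ?_, ?_⟩
    · intro m m' hm
      dsimp only
      split_ifs with h1 h2 h2
      · exact hmono hm
      · exact (hsub m).trans (Finset.subset_insert _ _)
      · omega
      · exact le_rfl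
    · intro m
      dsimp only
      split_ifs
      · exact (hsub m).trans (Finset.subset_insert _ _)
      · exact le_rfl
    · intro m hm
      rw [Finset.card_insert_of_notMem hu] at hm
      dsimp only
      split_ifs with h1
      · exact hcard m h1
      · rw [Finset.card_insert_of_notMem hu]
        omega
    · intro a
      by_cases ha : f u ≤ a
      · refine ⟨s.card + 1, by rw [Finset.card_insert_of_notMem hu], ?_⟩
        dsimp only
        rw [if_neg (by omega), Finset.filter_true_of_mem]
        intro v hv
        rcases Finset.mem_insert.1 hv with rfl | hv
        · exact ha
        · exact (hmax v hv).trans ha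
      · obtain ⟨m, hm, he⟩ := hlev a
        refine ⟨m, hm.trans (Finset.card_le_card (Finset.subset_insert _ _)), ?_⟩
        dsimp only
        rw [if_pos hm, Finset.filter_insert, if_neg ha, he]

/-- Binary expansion of a prefix: a prefix is a prefix of length a multiple of `2 ^ l` followed by
at most one aligned block of each length `2 ^ i` with `i < l`. -/
lemma abs_prefix_le {n : ℕ} (W : ℕ → ℝ) (Δ : ℕ → ℝ) (hΔ : ∀ i, 0 ≤ Δ i) :
    ∀ (l : ℕ) (D : ℝ), (∀ j, j * 2 ^ l ≤ n → |W (j * 2 ^ l)| ≤ D) →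
      (∀ i < l, ∀ j, (j + 1) * 2 ^ i ≤ n → |W ((j + 1) * 2 ^ i) - W (j * 2 ^ i)| ≤ Δ i) →
      ∀ m ≤ n, |W m| ≤ D + ∑ i ∈ Finset.range l, Δ i := by
  intro l
  induction l with
  | zero =>
    intro D hD _ m hm
    simpa using hD m (by simpa using hm)
  | succ l ih =>
    intro D hD hB m hm
    have key := ih (D + Δ l) ?_ (fun i hi => hB i (by omega)) m hm
    · rw [Finset.sum_range_succ]
      linarith
    · intro j hj
      rcases Nat.even_or_odd' j with ⟨s, rfl | rfl⟩
      · have h : 2 * s * 2 ^ l = s * 2 ^ (l + 1) := by ring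
        rw [h] at hj ⊢
        linarith [hD s hj, hΔ l]
      · have h : 2 * s * 2 ^ l = s * 2 ^ (l + 1) := by ring
        have h1 := hB l (by omega) (2 * s) hj
        have h2 := hD s (by rw [← h]; exact le_trans (Nat.mul_le_mul_right _ (by omega)) hj)
        rw [h] at h1
        have h3 := abs_add_le (W ((2 * s + 1) * 2 ^ l) - W (s * 2 ^ (l + 1))) (W (s * 2 ^ (l + 1)))
        rw [sub_add_cancel] at h3
        linarith

/-! ### Colourings with equal rounded prefix sums -/

/-- Two far-apart colourings on which the integer-valued functions `g · α` all agree exist as soon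
as these functions are small on average. The parameter `h α` tunes the code used for the values of
`g · α`: the larger it is, the cheaper the value `0` and the more expensive the other values. -/
lemma exists_far_pair_of_cost {ι A : Type*} [Fintype ι] [DecidableEq ι] [Fintype A]
    (hn : 0 < Fintype.card ι)
    (g : (ι → Bool) → A → ℤ) (h : A → ℕ) (B : A → ℝ)
    (hB : ∀ α, ∑ x, |(g x α : ℝ)| ≤ 2 ^ Fintype.card ι * B α)
    (hcost : ∑ α, (B α * ((h α + 1) * Real.log 3) + (1 / 3 : ℝ) ^ h α)
      ≤ (Fintype.card ι : ℝ) / 10) :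
    ∃ x x', g x = g x' ∧
      Fintype.card ι ≤ 10 * (Finset.univ.filter fun v => x v ≠ x' v).card := by
  have hlog : 0 ≤ Real.log 3 := Real.log_nonneg (by norm_num)
  have hkraft : ∀ α (Z : Finset ℤ),
      ∑ z ∈ Z, Real.exp (-(|(z : ℝ)| * ((h α + 1) * Real.log 3) + (1 / 3 : ℝ) ^ h α)) ≤ 1 := by
    intro α Z
    set r : ℝ := (1 / 3) ^ (h α + 1) with hr
    have hr0 : 0 < r := by positivity
    have hr3 : r ≤ 1 / 3 := by
      rw [hr, pow_succ]
      exact mul_le_of_le_one_left (by norm_num) (pow_le_one₀ (by norm_num) (by norm_num))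
    have hterm : ∀ z : ℤ,
        Real.exp (-(|(z : ℝ)| * ((h α + 1) * Real.log 3) + (1 / 3 : ℝ) ^ h α))
          = r ^ z.natAbs * Real.exp (-(1 / 3 : ℝ) ^ h α) := by
      intro z
      rw [neg_add, Real.exp_add]
      congr 1
      have h3 : Real.exp (-Real.log 3) = 1 / 3 := by
        rw [Real.exp_neg, Real.exp_log (by norm_num)]
        norm_num
      rw [hr, ← h3, ← pow_mul, ← Real.exp_nat_mul]
      congr 1
      rw [← Int.cast_abs, Int.abs_eq_natAbs, Int.cast_natCast]
      simp only [Nat.cast_mul, Nat.cast_add, Nat.cast_one]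
      ring
    simp only [hterm]
    rw [← Finset.sum_mul]
    have h1 := sum_pow_natAbs_le_exp hr0 (by linarith) Z
    have h2 : 2 * r / (1 - r) ≤ (1 / 3 : ℝ) ^ h α := by
      have h3 : (1 / 3 : ℝ) ^ h α = 3 * r := by
        rw [hr, pow_succ]
        ring
      rw [h3, div_le_iff₀ (by linarith)]
      nlinarith
    calc _ ≤ Real.exp ((1 / 3 : ℝ) ^ h α) * Real.exp (-(1 / 3 : ℝ) ^ h α) :=
          mul_le_mul_of_nonneg_right (h1.trans (Real.exp_le_exp.2 h2)) (Real.exp_pos _).le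
      _ = 1 := by rw [← Real.exp_add, add_neg_cancel, Real.exp_zero]
  have hcard : (Fintype.card (ι → Bool) : ℝ) = 2 ^ Fintype.card ι := by simp
  obtain ⟨b, hb⟩ := exists_large_fiber g _ hkraft (R := (Fintype.card ι : ℝ) / 10) (by
    rw [Finset.sum_comm, hcard]
    refine le_trans ?_ (mul_le_mul_of_nonneg_left hcost (by positivity))
    rw [Finset.mul_sum]
    refine Finset.sum_le_sum fun α _ => ?_
    rw [Finset.sum_add_distrib, ← Finset.sum_mul, mul_add]
    refine add_le_add ?_ (by simp)
    rw [← mul_assoc (2 ^ Fintype.card ι : ℝ)]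
    have hnn : 0 ≤ ((h α : ℝ) + 1) * Real.log 3 := by positivity
    exact mul_le_mul_of_nonneg_right (hB α) hnn)
  rw [hcard] at hb
  obtain ⟨x, hx, x', hx', hd⟩ := exists_far_pair _ hn hb
  exact ⟨x, x', (Finset.mem_filter.1 hx).2.trans (Finset.mem_filter.1 hx').2.symm, hd⟩

lemma abs_round_le (u : ℝ) : |(round u : ℝ)| ≤ 16 * u ^ 4 := by
  by_cases h0 : round u = 0
  · rw [h0]
    simp only [Int.cast_zero, abs_zero]
    positivity
  · have h1 : (1 : ℝ) ≤ |(round u : ℝ)| := by exact_mod_cast Int.one_le_abs h0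
    have h2 := abs_sub_round u
    have h3 : |(round u : ℝ)| ≤ |u| + |u - round u| := by
      have := abs_sub u (u - round u)
      simpa using this
    have h5 : u ^ 4 = |u| ^ 4 := by rw [← abs_pow, abs_of_nonneg (by positivity)]
    have h6 : 1 ≤ 2 * |u| := by linarith
    have h7 : 2 * |u| ≤ (2 * |u|) ^ 4 := le_self_pow₀ h6 (by norm_num)
    rw [h5]
    nlinarith

lemma abs_round_sub_round_le (u v : ℝ) : |((round u - round v : ℤ) : ℝ)| ≤ (u - v) ^ 4 + 2 := by
  have h1 := abs_le.1 (abs_sub_round u)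
  have h2 := abs_le.1 (abs_sub_round v)
  have h3 : |u - v| ≤ (u - v) ^ 4 + 1 := by
    have h4 : (u - v) ^ 4 = |u - v| ^ 4 := by rw [← abs_pow, abs_of_nonneg (by positivity)]
    rw [h4]
    rcases le_total |u - v| 1 with h | h
    · linarith [pow_nonneg (abs_nonneg (u - v)) 4]
    · linarith [le_self_pow₀ h (show 4 ≠ 0 by norm_num)]
  have h5 := abs_le.1 h3
  push_cast
  rw [abs_le]
  constructor <;> linarith [h5.1, h5.2, h1.1, h1.2, h2.1, h2.2]

lemma abs_sub_le_of_round_eq {u v : ℝ} (h : round u = round v) : |u - v| ≤ 1 := by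
  have h1 := abs_le.1 (abs_sub_round u)
  have h2 := abs_le.1 (abs_sub_round v)
  rw [h] at h1
  rw [abs_le]
  constructor <;> linarith [h1.1, h1.2, h2.1, h2.2]

lemma sum_succ_mul_pow_le (m : ℕ) :
    ∑ h ∈ Finset.range m, ((h : ℝ) + 1) * (2 / 3) ^ h ≤ 9 := by
  have key : ∑ h ∈ Finset.range m, ((h : ℝ) + 1) * (2 / 3) ^ h = 9 - (3 * m + 9) * (2 / 3) ^ m := by
    induction m with
    | zero => simp
    | succ m ih =>
      rw [Finset.sum_range_succ, ih]
      push_cast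
      ring
  rw [key]
  have : (0 : ℝ) ≤ (3 * m + 9) * (2 / 3) ^ m := by positivity
  linarith

lemma sum_geometric_le (m : ℕ) : ∑ h ∈ Finset.range m, (19 / 20 : ℝ) ^ h ≤ 20 := by
  rw [geom_sum_eq (by norm_num), show (19 / 20 - 1 : ℝ) = -(1 / 20) by norm_num, div_neg,
    div_eq_mul_inv]
  have : (0 : ℝ) ≤ (19 / 20) ^ m := by positivity
  norm_num
  linarith

/-- Sums over the blocks of a chain have the fourth moment of a simple random walk. -/
lemma sum_block_pow_four_le {ι : Type*} [Fintype ι] [DecidableEq ι] {c : ℕ → Finset ι}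
    (hmono : Monotone c) (hcard : ∀ m ≤ Fintype.card ι, (c m).card = m) {m m' : ℕ}
    (hm : m ≤ m') (hm' : m' ≤ Fintype.card ι) :
    ∑ x : ι → Bool, (∑ v ∈ c m', sgn (x v) - ∑ v ∈ c m, sgn (x v)) ^ 4
      ≤ 2 ^ Fintype.card ι * (3 * ((m' : ℝ) - m) ^ 2) := by
  have h1 : ((c m' \ c m).card : ℝ) = m' - m := by
    rw [Finset.card_sdiff_of_subset (hmono hm), hcard m' hm', hcard m (hm.trans hm'),
      Nat.cast_sub hm]
  rw [← h1]
  refine le_trans (le_of_eq ?_) (sum_signs_pow_four_le (c m' \ c m))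
  refine Finset.sum_congr rfl fun x _ => ?_
  rw [← Finset.sum_sdiff (hmono hm), add_sub_cancel_right]

/-- Two colourings that differ in a constant proportion of the points, but have nearly equal sums
over all members of the chains `c t`. Prefix sums at multiples of `2 ^ l` are rounded to multiples
of `√(2 ^ l)` and encoded through their increments; inside the blocks of length `2 ^ l`, the sums
over aligned blocks of length `2 ^ (l - h)` are rounded to multiples of
`√(2 ^ l) * (19 / 20) ^ h`. -/
lemma exists_far_pair_of_chains {ι κ : Type*} [Fintype ι] [DecidableEq ι] [Fintype κ]
    (hn : 0 < Fintype.card ι) (c : κ → ℕ → Finset ι) (h0 : ∀ t, c t 0 = ∅)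
    (hmono : ∀ t, Monotone (c t)) (hcard : ∀ t, ∀ m ≤ Fintype.card ι, (c t m).card = m)
    (l : ℕ) (hl : 9000 * (Fintype.card κ : ℝ) ≤ 2 ^ l) :
    ∃ x x' : ι → Bool,
      Fintype.card ι ≤ 10 * (Finset.univ.filter fun v => x v ≠ x' v).card ∧
      ∀ t, ∀ m ≤ Fintype.card ι,
        |∑ v ∈ c t m, sgn (x v) - ∑ v ∈ c t m, sgn (x' v)| ≤ 21 * √(2 ^ l) := by
  set n := Fintype.card ι with hndef
  set W : (ι → Bool) → κ → ℕ → ℝ := fun x t m => ∑ v ∈ c t m, sgn (x v) with hW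
  set D : ℝ := √(2 ^ l) with hD
  have hDpos : 0 < D := Real.sqrt_pos.2 (by positivity)
  have hD2 : D ^ 2 = 2 ^ l := Real.sq_sqrt (by positivity)
  have hD4 : D ^ 4 = (2 ^ l) ^ 2 := by rw [← hD2]; ring
  set Δ : ℕ → ℝ := fun h => D * (19 / 20) ^ h with hΔdef
  have hΔ : ∀ h, 0 < Δ h := fun h => by positivity
  have hlen : ∀ (s : ℕ) (j : Fin (n / s)), (j.1 + 1) * s ≤ n := fun s j =>
    (Nat.mul_le_mul_right _ j.2).trans (Nat.div_mul_le_self n s)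
  have hmom : ∀ t (s : ℕ) (j : Fin (n / s)),
      ∑ x, (W x t ((j.1 + 1) * s) - W x t (j.1 * s)) ^ 4 ≤ 2 ^ n * (3 * (s : ℝ) ^ 2) := by
    intro t s j
    have := sum_block_pow_four_le (hmono t) (hcard t)
      (Nat.mul_le_mul_right s (Nat.le_succ j.1)) (hlen s j)
    refine this.trans (le_of_eq ?_)
    push_cast
    ring
  set A := (κ × Fin (n / 2 ^ l)) ⊕ (κ × (Σ h : Fin (l + 1), Fin (n / 2 ^ (l - h.1)))) with hA
  set g : (ι → Bool) → A → ℤ := fun x => Sum.elim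
    (fun p => round (W x p.1 ((p.2.1 + 1) * 2 ^ l) / D) - round (W x p.1 (p.2.1 * 2 ^ l) / D))
    (fun p => round ((W x p.1 ((p.2.2.1 + 1) * 2 ^ (l - p.2.1.1))
      - W x p.1 (p.2.2.1 * 2 ^ (l - p.2.1.1))) / Δ p.2.1.1)) with hg
  obtain ⟨x, x', hxx, hfar⟩ := exists_far_pair_of_cost hn g
    (Sum.elim (fun _ => 0) (fun p => p.2.1.1))
    (Sum.elim (fun _ => 5) (fun p => 48 * (1 / 3 : ℝ) ^ p.2.1.1)) (by
      rintro (⟨t, j⟩ | ⟨t, h, j⟩)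
      · simp only [hg, Sum.elim_inl]
        calc _ ≤ ∑ x, ((W x t ((j.1 + 1) * 2 ^ l) - W x t (j.1 * 2 ^ l)) ^ 4 * (D ^ 4)⁻¹ + 2) := by
              refine Finset.sum_le_sum fun x _ => ?_
              refine (abs_round_sub_round_le _ _).trans (le_of_eq ?_)
              rw [← sub_div, div_pow, div_eq_mul_inv]
          _ ≤ 2 ^ n * (3 * ((2 ^ l : ℕ) : ℝ) ^ 2) * (D ^ 4)⁻¹ + 2 ^ n * 2 := by
              rw [Finset.sum_add_distrib, ← Finset.sum_mul]
              refine add_le_add (mul_le_mul_of_nonneg_right (hmom t _ j) (by positivity)) ?_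
              simp [hndef]
          _ = 2 ^ n * 5 := by
              rw [hD4]
              push_cast
              field_simp
              norm_num
      · simp only [hg, Sum.elim_inr]
        have hh : h.1 ≤ l := Nat.lt_succ_iff.1 h.2
        calc _ ≤ ∑ x, (W x t ((j.1 + 1) * 2 ^ (l - h.1)) - W x t (j.1 * 2 ^ (l - h.1))) ^ 4
                * (16 * (Δ h.1 ^ 4)⁻¹) := by
              refine Finset.sum_le_sum fun x _ => ?_
              refine (abs_round_le _).trans (le_of_eq ?_)
              rw [div_pow]
              ring
          _ ≤ 2 ^ n * (3 * ((2 ^ (l - h.1) : ℕ) : ℝ) ^ 2) * (16 * (Δ h.1 ^ 4)⁻¹) := by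
              rw [← Finset.sum_mul]
              exact mul_le_mul_of_nonneg_right (hmom t _ j) (by positivity)
          _ = 2 ^ n * (48 * (1 / (4 * (19 / 20) ^ 4)) ^ h.1) := by
              have hs : (2 : ℝ) ^ l = 2 ^ (l - h.1) * 2 ^ h.1 := by
                rw [← pow_add, Nat.sub_add_cancel hh]
              have h4 : (4 : ℝ) ^ h.1 = (2 ^ h.1) ^ 2 := by
                rw [← pow_mul, mul_comm, pow_mul]
                norm_num
              have h5 : (1 / (4 * (19 / 20) ^ 4) : ℝ) ^ h.1
                  = 1 / ((2 ^ h.1) ^ 2 * ((19 / 20) ^ h.1) ^ 4) := by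
                rw [one_div_pow, mul_pow, h4, pow_right_comm (19 / 20 : ℝ)]
              have h6 : (0 : ℝ) < (19 / 20) ^ h.1 := by positivity
              rw [h5, show Δ h.1 = D * (19 / 20) ^ h.1 from rfl, mul_pow, hD4, hs]
              generalize (19 / 20 : ℝ) ^ h.1 = u at h6
              push_cast
              field_simp
              norm_num
          -- `4 * (19 / 20) ^ 4 > 3`: block lengths shrink faster than the rounding is refined
          _ ≤ 2 ^ n * (48 * (1 / 3 : ℝ) ^ h.1) := by
              gcongr
              norm_num) (by
      -- there are `n / 2 ^ l * 2 ^ h` blocks at level `h`, each of cost `O((h + 1) * 3 ^ (-h))`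
      set k : ℝ := (Fintype.card κ : ℝ) with hk
      have hlog0 : 0 ≤ Real.log 3 := Real.log_nonneg (by norm_num)
      have hlog : Real.log 3 ≤ 2 := by
        have := Real.log_le_sub_one_of_pos (show (0 : ℝ) < 3 by norm_num)
        linarith
      have hlev : ∀ h ≤ l, ((n / 2 ^ (l - h) : ℕ) : ℝ) ≤ n / 2 ^ l * 2 ^ h := by
        intro h hh
        have hs : (2 : ℝ) ^ l = 2 ^ (l - h) * 2 ^ h := by
          rw [← pow_add, Nat.sub_add_cancel hh]
        refine Nat.cast_div_le.trans (le_of_eq ?_)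
        rw [hs]
        push_cast
        field_simp
      rw [Fintype.sum_sum_type, Fintype.sum_prod_type, Fintype.sum_prod_type]
      simp only [Sum.elim_inl, Sum.elim_inr, Fintype.sum_sigma, Finset.sum_const, Finset.card_univ,
        Fintype.card_fin, nsmul_eq_mul, ← hk]
      have hpart1 : ((n / 2 ^ l : ℕ) : ℝ) * (5 * ((((0 : ℕ) : ℝ) + 1) * Real.log 3)
          + (1 / 3 : ℝ) ^ 0) ≤ n / 2 ^ l * 11 := by
        have := hlev 0 (Nat.zero_le l)
        rw [Nat.sub_zero, pow_zero, mul_one] at this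
        refine mul_le_mul this ?_ (by positivity) (by positivity)
        norm_num
        linarith
      have hpart2 : ∑ h : Fin (l + 1), ((n / 2 ^ (l - h.1) : ℕ) : ℝ) *
          (48 * (1 / 3 : ℝ) ^ h.1 * (((h.1 : ℝ) + 1) * Real.log 3) + (1 / 3 : ℝ) ^ h.1)
          ≤ n / 2 ^ l * 873 := by
        calc _ ≤ ∑ h : Fin (l + 1), n / 2 ^ l * 97 * (((h.1 : ℝ) + 1) * (2 / 3) ^ h.1) := by
              refine Finset.sum_le_sum fun h _ => ?_
              have hh : h.1 ≤ l := Nat.lt_succ_iff.1 h.2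
              have h1 : 48 * (1 / 3 : ℝ) ^ h.1 * (((h.1 : ℝ) + 1) * Real.log 3) + (1 / 3 : ℝ) ^ h.1
                  ≤ 97 * ((h.1 : ℝ) + 1) * (1 / 3) ^ h.1 := by
                have h2 : 48 * (((h.1 : ℝ) + 1) * Real.log 3) + 1 ≤ 97 * ((h.1 : ℝ) + 1) := by
                  nlinarith [(Nat.cast_nonneg h.1 : (0 : ℝ) ≤ h.1)]
                calc _ = (48 * (((h.1 : ℝ) + 1) * Real.log 3) + 1) * (1 / 3 : ℝ) ^ h.1 := by ring
                  _ ≤ _ := mul_le_mul_of_nonneg_right h2 (by positivity)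
              refine (mul_le_mul (hlev h.1 hh) h1 (by positivity) (by positivity)).trans
                (le_of_eq ?_)
              rw [show (2 / 3 : ℝ) = 2 * (1 / 3) by norm_num, mul_pow]
              ring
          _ = n / 2 ^ l * 97 * ∑ h ∈ Finset.range (l + 1), ((h : ℝ) + 1) * (2 / 3) ^ h := by
              rw [← Finset.mul_sum, ← Fin.sum_univ_eq_sum_range
                (fun h => ((h : ℝ) + 1) * (2 / 3) ^ h)]
          _ ≤ n / 2 ^ l * 97 * 9 :=
              mul_le_mul_of_nonneg_left (sum_succ_mul_pow_le _) (by positivity)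
          _ = _ := by ring
      have hk0 : 0 ≤ k := Nat.cast_nonneg _
      calc _ ≤ k * (n / 2 ^ l * 11) + k * (n / 2 ^ l * 873) :=
            add_le_add (mul_le_mul_of_nonneg_left hpart1 hk0)
              (mul_le_mul_of_nonneg_left hpart2 hk0)
        _ = n * (884 * k) / 2 ^ l := by ring
        _ ≤ n / 10 := by
            rw [div_le_div_iff₀ (by positivity) (by norm_num)]
            have : 0 ≤ (n : ℝ) := Nat.cast_nonneg _
            nlinarith)
  refine ⟨x, x', hfar, fun t m hm => ?_⟩
  -- prefixes at multiples of `2 ^ l`: the increments of the rounded sums agree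
  have htop : ∀ j, j * 2 ^ l ≤ n → |W x t (j * 2 ^ l) - W x' t (j * 2 ^ l)| ≤ D := by
    have hround : ∀ j, j * 2 ^ l ≤ n →
        round (W x t (j * 2 ^ l) / D) = round (W x' t (j * 2 ^ l) / D) := by
      intro j
      induction j with
      | zero => intro _; simp [hW, h0]
      | succ j ih =>
        intro hj
        have hlt : j < n / 2 ^ l := (Nat.le_div_iff_mul_le (by positivity)).2 hj
        have h1 := congrFun hxx (Sum.inl (t, ⟨j, hlt⟩))
        simp only [hg, Sum.elim_inl] at h1
        have h2 := ih ((Nat.mul_le_mul_right _ (Nat.le_succ j)).trans hj)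
        linarith
    intro j hj
    have := abs_sub_le_of_round_eq (hround j hj)
    rwa [← sub_div, abs_div, abs_of_pos hDpos, div_le_one hDpos] at this
  have hblock : ∀ i < l, ∀ j, (j + 1) * 2 ^ i ≤ n →
      |(W x t ((j + 1) * 2 ^ i) - W x' t ((j + 1) * 2 ^ i))
        - (W x t (j * 2 ^ i) - W x' t (j * 2 ^ i))| ≤ Δ (l - i) := by
    intro i hi j hj
    have hii : l - (l - i) = i := by omega
    have hlt : j < n / 2 ^ (l - (l - i)) := by
      rw [hii]
      exact (Nat.le_div_iff_mul_le (by positivity)).2 hj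
    have h1 := congrFun hxx (Sum.inr (t, ⟨⟨l - i, by omega⟩, ⟨j, hlt⟩⟩))
    simp only [hg, Sum.elim_inr, hii] at h1
    have := abs_sub_le_of_round_eq h1
    rw [← sub_div, abs_div, abs_of_pos (hΔ _), div_le_one (hΔ _)] at this
    refine le_trans (le_of_eq ?_) this
    congr 1
    ring
  have hfin := abs_prefix_le (n := n) (fun m => W x t m - W x' t m) (fun i => Δ (l - i))
    (fun i => (hΔ _).le) l D htop hblock m hm
  refine hfin.trans ?_
  have hsum : ∑ i ∈ Finset.range l, Δ (l - i) ≤ D * 20 := by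
    calc ∑ i ∈ Finset.range l, Δ (l - i)
        ≤ ∑ i ∈ Finset.range (l + 1), Δ (l - i) :=
          Finset.sum_le_sum_of_subset_of_nonneg (Finset.range_subset_range.2 (Nat.le_succ l))
            fun i _ _ => (hΔ _).le
      _ = ∑ i ∈ Finset.range (l + 1), Δ i := by
          rw [← Finset.sum_range_reflect Δ (l + 1)]
          exact Finset.sum_congr rfl fun i _ => by congr 1
      _ = D * ∑ i ∈ Finset.range (l + 1), (19 / 20 : ℝ) ^ i := by rw [Finset.mul_sum]
      _ ≤ D * 20 := mul_le_mul_of_nonneg_left (sum_geometric_le _) hDpos.le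
  linarith

/-! ### Discrepancy of sublevel sets -/

/-- For `k` functions on a set of `n` points there is a partial colouring with values in
`{-1, 0, 1}`, nonzero on at least `n / 10` points, under which all sublevel sets of the functions
have discrepancy `O(√k)`. -/
lemma exists_partial_coloring_fintype {ι κ : Type*} [Fintype ι] [Nonempty ι] [Fintype κ]
    [Nonempty κ] (f : κ → ι → ℝ) :
    ∃ y : ι → ℝ, (∀ v, y v = 0 ∨ y v = 1 ∨ y v = -1) ∧
      Fintype.card ι ≤ 10 * (Finset.univ.filter fun v => y v ≠ 0).card ∧
      ∀ t a, |∑ v with f t v ≤ a, y v| ≤ 1500 * √(Fintype.card κ) := by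
  classical
  -- `21 / 2 * √(18000 k) ≤ 1500 √k`, the factor `1 / 2` coming from half the difference
  choose c h0 hmono _ hcard hlev using fun t => exists_chain (f t) Finset.univ
  set k := Fintype.card κ with hk
  have hkpos : 0 < k := Fintype.card_pos
  set l := Nat.clog 2 (9000 * k) with hl
  have hl1 : 9000 * k ≤ 2 ^ l := Nat.le_pow_clog (by norm_num) _
  have hl2 : 2 ^ l ≤ 18000 * k := by
    have h1 := Nat.pow_pred_clog_lt_self (b := 2) (by norm_num) (show 1 < 9000 * k by omega)
    rw [← hl] at h1
    have h2 : l ≠ 0 := by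
      intro h
      rw [h] at hl1
      omega
    obtain ⟨m, hm⟩ := Nat.exists_eq_succ_of_ne_zero h2
    rw [hm] at h1 ⊢
    rw [Nat.pow_succ]
    simp only [Nat.pred_succ, Nat.succ_eq_add_one] at h1
    omega
  obtain ⟨x, x', hfar, hdisc⟩ := exists_far_pair_of_chains (Fintype.card_pos (α := ι)) c h0 hmono
    hcard l (by exact_mod_cast hl1)
  refine ⟨fun v => (sgn (x v) - sgn (x' v)) / 2, fun v => ?_, ?_, fun t a => ?_⟩
  · dsimp only
    cases x v <;> cases x' v <;> norm_num [sgn]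
  · refine hfar.trans (Nat.mul_le_mul_left _ (Finset.card_le_card fun v hv => ?_))
    have hv' := (Finset.mem_filter.1 hv).2
    refine Finset.mem_filter.2 ⟨Finset.mem_univ v, ?_⟩
    dsimp only
    revert hv'
    cases x v <;> cases x' v <;> norm_num [sgn]
  · obtain ⟨m, hm, he⟩ := hlev t a
    rw [he, ← Finset.sum_div, Finset.sum_sub_distrib, abs_div, abs_two]
    have h1 := hdisc t m hm
    have h2 : √((2 : ℝ) ^ l) ≤ 135 * √k := by
      rw [Real.sqrt_le_iff]
      refine ⟨by positivity, ?_⟩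
      rw [mul_pow, Real.sq_sqrt (Nat.cast_nonneg k)]
      have h3 : (2 : ℝ) ^ l ≤ 18000 * k := by exact_mod_cast hl2
      have h4 : (0 : ℝ) ≤ k := Nat.cast_nonneg k
      linarith
    have h3 : 0 ≤ √(k : ℝ) := Real.sqrt_nonneg _
    linarith

lemma exists_partial_coloring {ι κ : Type*} [Fintype κ] [Nonempty κ] (f : κ → ι → ℝ)
    {V : Finset ι} (hV : V.Nonempty) :
    ∃ y : ι → ℝ, (∀ v, y v = 0 ∨ y v = 1 ∨ y v = -1) ∧
      V.card ≤ 10 * (V.filter fun v => y v ≠ 0).card ∧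
      ∀ t a, |∑ v ∈ V with f t v ≤ a, y v| ≤ 1500 * √(Fintype.card κ) := by
  classical
  have : Nonempty V := hV.to_subtype
  obtain ⟨y, hy, hcard, hdisc⟩ := exists_partial_coloring_fintype fun t (v : V) => f t v
  set y' : ι → ℝ := fun v => if h : v ∈ V then y ⟨v, h⟩ else 0 with hy'
  have hyy : ∀ v : V, y' v = y v := fun v => by simp [hy']
  refine ⟨y', fun v => ?_, ?_, fun t a => ?_⟩
  · by_cases h : v ∈ V
    · simpa [hy', h] using hy ⟨v, h⟩
    · simp [hy', h]
  · rw [Fintype.card_coe] at hcard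
    refine hcard.trans (le_of_eq ?_)
    rw [Finset.card_filter, Finset.card_filter, ← Finset.sum_coe_sort V]
    simp only [hyy]
  · refine le_trans (le_of_eq ?_) (hdisc t a)
    rw [Finset.sum_filter, Finset.sum_filter, ← Finset.sum_coe_sort V]
    simp only [hyy]

/-- Iterating partial colourings on the points that are still uncoloured gives a colouring with
discrepancy `O(√k * log n)`. -/
lemma exists_coloring {ι κ : Type*} [Fintype κ] [Nonempty κ] (f : κ → ι → ℝ) (V : Finset ι) :
    ∃ z : ι → ℝ, (∀ v, z v = 1 ∨ z v = -1) ∧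
      ∀ t a, |∑ v ∈ V with f t v ≤ a, z v|
        ≤ 15000 * √(Fintype.card κ) * (1 + Real.log V.card) := by
  classical
  induction V using Finset.strongInduction with
  | H V ih =>
    rcases V.eq_empty_or_nonempty with rfl | hV
    · refine ⟨fun _ => 1, fun _ => Or.inl rfl, fun t a => ?_⟩
      simp
    obtain ⟨y, hy, hcard, hdisc⟩ := exists_partial_coloring f hV
    set U := V.filter fun v => y v = 0 with hU
    have hsplit : U.card + (V.filter fun v => y v ≠ 0).card = V.card :=
      Finset.card_filter_add_card_filter_not _
    have hVpos := hV.card_pos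
    have hUV : U ⊂ V := by
      refine Finset.ssubset_iff_subset_ne.2 ⟨Finset.filter_subset _ _, fun h => ?_⟩
      rw [h] at hsplit
      omega
    obtain ⟨z, hz, hzdisc⟩ := ih U hUV
    refine ⟨fun v => if y v = 0 then z v else y v, fun v => ?_, fun t a => ?_⟩
    · dsimp only
      split_ifs with h
      · exact hz v
      · exact (hy v).resolve_left h
    · have hsum : ∑ v ∈ V with f t v ≤ a, (if y v = 0 then z v else y v)
          = ∑ v ∈ V with f t v ≤ a, y v + ∑ v ∈ U with f t v ≤ a, z v := by
        rw [hU, Finset.filter_filter, Finset.sum_filter, Finset.sum_filter, Finset.sum_filter,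
          ← Finset.sum_add_distrib]
        refine Finset.sum_congr rfl fun v _ => ?_
        by_cases h1 : f t v ≤ a <;> by_cases h2 : y v = 0 <;> simp [h1, h2]
      rw [hsum]
      refine (abs_add_le _ _).trans ?_
      have hK : 0 ≤ √(Fintype.card κ : ℝ) := Real.sqrt_nonneg _
      have hlogV : 0 ≤ Real.log V.card := Real.log_natCast_nonneg _
      have h1 := hdisc t a
      rcases U.eq_empty_or_nonempty with hU0 | hUne
      · rw [hU0]
        simp only [Finset.filter_empty, Finset.sum_empty, abs_zero, add_zero]
        refine h1.trans ?_
        nlinarith [mul_nonneg hK hlogV]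
      · -- at most `9 / 10` of the points are left, so the logarithm drops by at least `1 / 10`
        have h2 := hzdisc t a
        have hUpos : (0 : ℝ) < U.card := by exact_mod_cast hUne.card_pos
        have hVpos' : (0 : ℝ) < V.card := by exact_mod_cast hVpos
        have h3 : (U.card : ℝ) ≤ 9 / 10 * V.card := by
          have : 10 * U.card ≤ 9 * V.card := by omega
          have : (10 : ℝ) * U.card ≤ 9 * V.card := by exact_mod_cast this
          linarith
        have h4 : Real.log U.card ≤ Real.log V.card - 1 / 10 := by
          have h5 := Real.log_le_log hUpos h3
          rw [Real.log_mul (by norm_num) hVpos'.ne'] at h5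
          have h6 := Real.log_le_sub_one_of_pos (show (0 : ℝ) < 9 / 10 by norm_num)
          linarith
        have h7 := mul_le_mul_of_nonneg_left h4 hK
        nlinarith

/-! ### Halving -/

/-- The proportion of points of `V` at which `f` is at most `a`. -/
noncomputable def lowFrac {ι : Type*} (f : ι → ℝ) (V : Finset ι) (a : ℝ) : ℝ :=
  ((V.filter fun v => f v ≤ a).card : ℝ) / V.card

lemma exists_filter_le_eq_self {ι : Type*} (f : ι → ℝ) (V : Finset ι) :
    ∃ a, V.filter (fun v => f v ≤ a) = V := by
  obtain ⟨a, ha⟩ := (V.image f).bddAbove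
  exact ⟨a, Finset.filter_true_of_mem fun v hv =>
    ha (Finset.mem_coe.2 (Finset.mem_image_of_mem f hv))⟩

/-- The smaller colour class of a colouring with discrepancy `δ` has the same proportions of
points in sublevel sets as the whole set, up to `2 * δ / n`. -/
lemma exists_half {ι κ : Type*} [Nonempty κ] (f : κ → ι → ℝ) (V : Finset ι) {z : ι → ℝ}
    (hz : ∀ v, z v = 1 ∨ z v = -1) {δ : ℝ} (hδ : δ < V.card)
    (hdisc : ∀ t a, |∑ v ∈ V with f t v ≤ a, z v| ≤ δ) :
    ∃ U ⊆ V, U.Nonempty ∧ 2 * U.card ≤ V.card ∧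
      ∀ t a, |lowFrac (f t) V a - lowFrac (f t) U a| ≤ 2 * δ / V.card := by
  classical
  wlog hneg : ∑ v ∈ V, z v ≤ 0 generalizing z
  · refine this (z := fun v => -z v) (fun v => ?_) (fun t a => ?_) ?_
    · rcases hz v with h | h <;> simp [h]
    · rw [Finset.sum_neg_distrib, abs_neg]
      exact hdisc t a
    · rw [Finset.sum_neg_distrib]
      linarith
  have hδ0 : 0 ≤ δ := (abs_nonneg _).trans (hdisc (Classical.arbitrary κ) 0)
  have hV : (0 : ℝ) < V.card := hδ0.trans_lt hδ
  set U := V.filter fun v => z v = 1 with hU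
  have hcount : ∀ p : ι → Prop, 2 * ((U.filter p).card : ℝ)
      = (V.filter p).card + ∑ v ∈ V with p v, z v := by
    intro p
    rw [hU, Finset.filter_filter, Finset.card_filter, Finset.card_filter, Finset.sum_filter]
    push_cast
    rw [Finset.mul_sum, ← Finset.sum_add_distrib]
    refine Finset.sum_congr rfl fun v _ => ?_
    by_cases hp : p v
    · rcases hz v with h | h <;> norm_num [h, hp]
    · simp [hp]
  obtain ⟨a₀, ha₀⟩ := exists_filter_le_eq_self (f (Classical.arbitrary κ)) V
  have hall : |∑ v ∈ V, z v| ≤ δ := by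
    have := hdisc (Classical.arbitrary κ) a₀
    rwa [ha₀] at this
  have hUc : 2 * (U.card : ℝ) = V.card + ∑ v ∈ V, z v := by
    have := hcount fun _ => True
    simpa using this
  have hUpos : (0 : ℝ) < U.card := by
    have := (abs_le.1 hall).1
    linarith
  refine ⟨U, Finset.filter_subset _ _, ?_, ?_, fun t a => ?_⟩
  · exact Finset.card_pos.1 (by exact_mod_cast hUpos)
  · have : 2 * (U.card : ℝ) ≤ V.card := by linarith
    exact_mod_cast this
  · unfold lowFrac
    have h1 := hcount fun v => f t v ≤ a
    have h2 := hdisc t a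
    set e := ∑ v ∈ V with f t v ≤ a, z v
    set s := ∑ v ∈ V, z v
    set u : ℝ := ((U.filter fun v => f t v ≤ a).card : ℝ)
    have hu : u ≤ U.card := Nat.cast_le.2 (Finset.card_filter_le _ _)
    have hu0 : 0 ≤ u := Nat.cast_nonneg _
    have h3 : ((V.filter fun v => f t v ≤ a).card : ℝ) / V.card - u / U.card
        = (u / U.card * s - e) / V.card := by
      rw [show ((V.filter fun v => f t v ≤ a).card : ℝ) = 2 * u - e by linarith,
        show s = 2 * (U.card : ℝ) - V.card by linarith]
      field_simp
      ring
    rw [h3, abs_div, abs_of_pos hV]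
    refine div_le_div_of_nonneg_right ?_ hV.le
    have h4 : |u / U.card * s| ≤ δ := by
      rw [abs_mul, abs_of_nonneg (by positivity)]
      exact (mul_le_of_le_one_left (abs_nonneg _) ((div_le_one hUpos).2 hu)).trans hall
    have h5 := abs_sub (u / U.card * s) e
    linarith

lemma three_add_log_div_antitone {x y : ℝ} (hx : 1 ≤ x) (hxy : x ≤ y) :
    (3 + Real.log y) / y ≤ (3 + Real.log x) / x := by
  have hx0 : 0 < x := by linarith
  have hy0 : 0 < y := by linarith
  rw [div_le_div_iff₀ hy0 hx0]
  have h1 : Real.log y ≤ Real.log x + (y / x - 1) := by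
    have := Real.log_le_sub_one_of_pos (div_pos hy0 hx0)
    rw [Real.log_div hy0.ne' hx0.ne'] at this
    linarith
  have h2 : Real.log y * x ≤ Real.log x * x + (y - x) := by
    have h3 := mul_le_mul_of_nonneg_right h1 hx0.le
    have h4 : (y / x - 1) * x = y - x := by field_simp
    linarith
  nlinarith [mul_nonneg (Real.log_nonneg hx) (sub_nonneg.2 hxy)]

/-- Repeated halving down to at most `M` points. The error made in one step from `n` points is at
most `A * (1 + log n) / n`, which is dominated by the increase from `n` to `n / 2` of
`x ↦ A * (3 + log x) / x`; hence the errors telescope. -/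
lemma exists_subset_of_coloring {ι κ : Type*} [Nonempty κ] (f : κ → ι → ℝ) {A : ℝ} (hA : 0 ≤ A)
    (hcol : ∀ V : Finset ι, ∃ z : ι → ℝ, (∀ v, z v = 1 ∨ z v = -1) ∧
      ∀ t a, |∑ v ∈ V with f t v ≤ a, z v| ≤ A / 2 * (1 + Real.log V.card))
    {M : ℝ} (hM : 2 ≤ M) (hM1 : A * ((3 + Real.log (M / 2)) / (M / 2)) ≤ 1) (V : Finset ι)
    (hMV : M < V.card) :
    ∃ T ⊆ V, T.Nonempty ∧ (T.card : ℝ) ≤ M ∧ ∀ t a,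
      |lowFrac (f t) V a - lowFrac (f t) T a| ≤
        A * ((3 + Real.log (M / 2)) / (M / 2)) - A * ((3 + Real.log V.card) / V.card) := by
  classical
  induction V using Finset.strongInduction with
  | H V ih =>
    obtain ⟨z, hz, hdisc⟩ := hcol V
    set n : ℝ := (V.card : ℝ) with hn
    have hn0 : 0 < n := by linarith
    have hlogn : 0 ≤ Real.log n := Real.log_natCast_nonneg _
    have hstep : 2 * (A / 2 * (1 + Real.log n)) / n
        ≤ A * ((3 + Real.log (n / 2)) / (n / 2)) - A * ((3 + Real.log n) / n) := by
      have h1 : A * ((3 + Real.log (n / 2)) / (n / 2)) - A * ((3 + Real.log n) / n)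
          = A * (3 + Real.log n - 2 * Real.log 2) / n := by
        rw [Real.log_div hn0.ne' (by norm_num)]
        field_simp
        ring
      rw [h1]
      refine div_le_div_of_nonneg_right ?_ hn0.le
      have := Real.log_le_sub_one_of_pos (show (0 : ℝ) < 2 by norm_num)
      nlinarith
    have hhalf : A * ((3 + Real.log (n / 2)) / (n / 2)) ≤ A * ((3 + Real.log (M / 2)) / (M / 2)) :=
      mul_le_mul_of_nonneg_left (three_add_log_div_antitone (by linarith) (by linarith)) hA
    have hδ : A / 2 * (1 + Real.log n) < n := by
      have h1 : 0 ≤ A * ((3 + Real.log n) / n) := by positivity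
      have h2 : 2 * (A / 2 * (1 + Real.log n)) / n ≤ 1 := by linarith
      rw [div_le_one hn0] at h2
      linarith
    obtain ⟨U, hUV, hUne, hUcard, hU⟩ := exists_half f V hz hδ hdisc
    have hUcard' : (U.card : ℝ) ≤ n / 2 := by
      have : (2 : ℝ) * U.card ≤ V.card := by exact_mod_cast hUcard
      linarith
    rcases le_or_gt (U.card : ℝ) M with hle | hlt
    · refine ⟨U, hUV, hUne, hle, fun t a => ?_⟩
      linarith [hU t a]
    · have hss : U ⊂ V := by
        refine Finset.ssubset_iff_subset_ne.2 ⟨hUV, fun h => ?_⟩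
        rw [h] at hUcard'
        linarith
      obtain ⟨T, hTU, hTne, hTM, hT⟩ := ih U hss hlt
      refine ⟨T, hTU.trans hUV, hTne, hTM, fun t a => ?_⟩
      have h1 := abs_sub_le (lowFrac (f t) V a) (lowFrac (f t) U a) (lowFrac (f t) T a)
      have h2 := mul_le_mul_of_nonneg_left
        (three_add_log_div_antitone (x := U.card) (y := n / 2) (by linarith) hUcard') hA
      linarith [hU t a, hT t a]

/-- Common approximation of the sublevel sets of `k` functions by few points. -/
lemma exists_common_approximation {ι κ : Type*} [Fintype κ] [Nonempty κ] (f : κ → ι → ℝ)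
    {V : Finset ι} (hV : V.Nonempty) {ε : ℝ} (hε : 0 < ε) (hε1 : ε ≤ 1)
    (hkε : 2 ≤ Fintype.card κ / ε) :
    ∃ T ⊆ V, T.Nonempty ∧
      (T.card : ℝ) ≤ 10 ^ 7 * (√(Fintype.card κ) / ε) * Real.log (Fintype.card κ / ε) ∧
      ∀ t a, |lowFrac (f t) V a - lowFrac (f t) T a| ≤ ε := by
  set k : ℝ := (Fintype.card κ : ℝ) with hk
  have hk1 : 1 ≤ k := Nat.one_le_cast.2 Fintype.card_pos
  set r : ℝ := √k with hr
  have hr1 : 1 ≤ r := by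
    rw [hr]
    exact Real.one_le_sqrt.2 hk1
  have hrk : r ≤ k := by
    have h := Real.sq_sqrt (show 0 ≤ k by linarith)
    rw [← hr] at h
    nlinarith
  set Λ := Real.log (k / ε) with hΛ
  have hΛ1 : 1 / 2 ≤ Λ := by
    have h1 := Real.log_le_log (by norm_num) hkε
    have h2 := Real.one_sub_inv_le_log_of_pos (show (0 : ℝ) < 2 by norm_num)
    norm_num at h2
    linarith
  set M := 10 ^ 7 * (r / ε) * Λ with hM
  have hrε : 1 ≤ r / ε := by
    rw [le_div_iff₀ hε]
    linarith
  have hM2 : 2 ≤ M := by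
    rw [hM]
    nlinarith
  have hlogM : Real.log (M / 2) ≤ 63 + 2 * Λ := by
    have h1 : Real.log (10 ^ 7) ≤ 63 := by
      rw [Real.log_pow]
      have := Real.log_le_sub_one_of_pos (show (0 : ℝ) < 10 by norm_num)
      push_cast
      linarith
    have h2 : Real.log (r / ε) ≤ Λ :=
      Real.log_le_log (by linarith) (div_le_div_of_nonneg_right hrk hε.le)
    have h3 : Real.log Λ ≤ Λ - 1 := Real.log_le_sub_one_of_pos (by linarith)
    have h4 : Real.log M = Real.log (10 ^ 7) + Real.log (r / ε) + Real.log Λ := by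
      rw [hM, Real.log_mul (by positivity) (by linarith), Real.log_mul (by norm_num) (by linarith)]
    have h5 : Real.log (M / 2) ≤ Real.log M := Real.log_le_log (by linarith) (by linarith)
    calc Real.log (M / 2) ≤ Real.log (10 ^ 7) + Real.log (r / ε) + Real.log Λ := h5.trans h4.le
      _ ≤ 63 + Λ + (Λ - 1) := add_le_add (add_le_add h1 h2) h3
      _ ≤ 63 + 2 * Λ := by linarith
  have hbound : 30000 * r * ((3 + Real.log (M / 2)) / (M / 2)) ≤ ε := by
    rw [← mul_div_assoc, div_le_iff₀ (by linarith)]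
    have h1 : ε * (M / 2) = r * (10 ^ 7 / 2 * Λ) := by
      rw [hM]
      field_simp
    rw [h1, mul_comm 30000 r, mul_assoc]
    refine mul_le_mul_of_nonneg_left ?_ (by linarith)
    linarith
  rcases le_or_gt (V.card : ℝ) M with hle | hlt
  · exact ⟨V, subset_rfl, hV, hle, fun t a => by simpa using hε.le⟩
  · obtain ⟨T, hTV, hTne, hTM, hT⟩ := exists_subset_of_coloring f (A := 30000 * r) (by linarith)
      (fun V => by
        obtain ⟨z, hz, hd⟩ := exists_coloring f V
        refine ⟨z, hz, fun t a => (hd t a).trans (le_of_eq ?_)⟩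
        rw [← hk, ← hr]
        ring) hM2 (hbound.trans hε1) V hlt
    refine ⟨T, hTV, hTne, hTM, fun t a => ?_⟩
    have h1 : 0 ≤ Real.log (V.card : ℝ) := Real.log_natCast_nonneg _
    have h2 : 0 ≤ 30000 * r * ((3 + Real.log V.card) / V.card) := by positivity
    linarith [hT t a]

/-- For a single function, a median approximates all sublevel sets up to `1 / 2`. -/
lemma exists_median {ι : Type*} (f : ι → ℝ) {V : Finset ι} (hV : V.Nonempty) :
    ∃ v ∈ V, ∀ a, |lowFrac f V a - lowFrac f {v} a| ≤ 1 / 2 := by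
  classical
  have hpos : (0 : ℝ) < V.card := by exact_mod_cast hV.card_pos
  set S := V.filter fun v => V.card ≤ 2 * (V.filter fun u => f u ≤ f v).card with hS
  obtain ⟨w, hw, hwmax⟩ := V.exists_max_image f hV
  have hSne : S.Nonempty := by
    refine ⟨w, Finset.mem_filter.2 ⟨hw, ?_⟩⟩
    rw [Finset.filter_true_of_mem hwmax]
    omega
  obtain ⟨v, hv, hvmin⟩ := S.exists_min_image f hSne
  obtain ⟨hvV, hvc⟩ := Finset.mem_filter.1 hv
  refine ⟨v, hvV, fun a => ?_⟩
  unfold lowFrac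
  have hle : ((V.filter fun u => f u ≤ a).card : ℝ) / V.card ≤ 1 :=
    (div_le_one hpos).2 (by exact_mod_cast Finset.card_filter_le _ _)
  have hnn : 0 ≤ ((V.filter fun u => f u ≤ a).card : ℝ) / V.card := by positivity
  rcases le_or_gt (f v) a with hva | hva
  · have h1 : (1 / 2 : ℝ) ≤ ((V.filter fun u => f u ≤ a).card : ℝ) / V.card := by
      rw [le_div_iff₀ hpos]
      have h2 : (V.filter fun u => f u ≤ f v).card ≤ (V.filter fun u => f u ≤ a).card :=
        Finset.card_le_card fun u hu => by
          simp only [Finset.mem_filter] at hu ⊢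
          exact ⟨hu.1, hu.2.trans hva⟩
      have h3 : (V.card : ℝ) ≤ 2 * (V.filter fun u => f u ≤ a).card := by
        exact_mod_cast hvc.trans (Nat.mul_le_mul_left 2 h2)
      linarith
    rw [Finset.filter_singleton, if_pos hva]
    simp only [Finset.card_singleton, Nat.cast_one, div_one]
    rw [abs_le]
    constructor <;> linarith
  · have h1 : ((V.filter fun u => f u ≤ a).card : ℝ) / V.card ≤ 1 / 2 := by
      rw [div_le_iff₀ hpos]
      rcases (V.filter fun u => f u ≤ a).eq_empty_or_nonempty with h0 | hne
      · rw [h0]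
        simp
      · obtain ⟨u, hu, humax⟩ := (V.filter fun u => f u ≤ a).exists_max_image f hne
        obtain ⟨huV, hua⟩ := Finset.mem_filter.1 hu
        have huS : u ∉ S := fun h => by linarith [hvmin u h]
        have h2 : 2 * (V.filter fun x => f x ≤ f u).card < V.card := by
          by_contra hcon
          exact huS (Finset.mem_filter.2 ⟨huV, not_lt.1 hcon⟩)
        have h3 : (V.filter fun x => f x ≤ a).card ≤ (V.filter fun x => f x ≤ f u).card :=
          Finset.card_le_card fun x hx =>
            Finset.mem_filter.2 ⟨(Finset.mem_filter.1 hx).1, humax x hx⟩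
        have h4 : (2 : ℝ) * (V.filter fun x => f x ≤ a).card ≤ V.card := by
          exact_mod_cast (Nat.mul_le_mul_left 2 h3).trans h2.le
        linarith
    rw [Finset.filter_singleton, if_neg (not_le.2 hva)]
    simp only [Finset.card_empty, Nat.cast_zero, zero_div, sub_zero]
    rw [abs_le]
    constructor <;> linarith

/-! ### Inclusion probabilities and sublevel sets -/

lemma isProbabilityMeasure_law {E : Type*} [MeasurableSpace E] {k : ℕ} (hk : k ≠ 0)
    (p : Fin k → E) : IsProbabilityMeasure (law p) := by
  refine ⟨?_⟩
  unfold law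
  rw [Measure.finsetSum_apply]
  simp [ENNReal.mul_inv_cancel (Nat.cast_ne_zero.2 hk) (ENNReal.natCast_ne_top k)]

lemma inclusionProb_Iic {ι : Type*} [Fintype ι] {k : ℕ} (hk : k ≠ 0) (P : ι → Fin k → ℝ) (i : ι)
    (a : ℝ) :
    inclusionProb P (Set.Iic a) i
      = ((Finset.univ.filter fun j => P i j ≤ a).card : ℝ) / k := by
  have : ∀ i, IsProbabilityMeasure (law (P i)) := fun i => isProbabilityMeasure_law hk (P i)
  have h1 : transversalMeasure P {Q | Q i ∈ Set.Iic a} = law (P i) (Set.Iic a) :=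
    (measurePreserving_eval (fun i => law (P i)) i).measure_preimage
      measurableSet_Iic.nullMeasurableSet
  unfold inclusionProb Measure.real
  rw [h1]
  unfold law
  rw [Measure.finsetSum_apply]
  simp only [Measure.smul_apply, Measure.dirac_apply' _ measurableSet_Iic, smul_eq_mul]
  rw [← Finset.mul_sum, ENNReal.toReal_mul]
  simp [Set.indicator_apply, Finset.sum_boole, div_eq_inv_mul]

/-- The `t`-th smallest location is at most `a` precisely if at least `t` locations are. -/
lemma kthSmallest_le_iff {k : ℕ} (p : Fin k → ℝ) (j : Fin k) (a : ℝ) :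
    kthSmallest p j ≤ a ↔ j.1 + 1 ≤ (Finset.univ.filter fun i => p i ≤ a).card := by
  have h1 := Tuple.lt_card_le_iff_apply_le_of_monotone (a := a)
    (Tuple.monotone_sort p) (j := j)
  have h2 : (Finset.univ.filter fun i => (p ∘ Tuple.sort p) i ≤ a).card
      = (Finset.univ.filter fun i => p i ≤ a).card := by
    rw [← Fintype.card_subtype, ← Fintype.card_subtype]
    exact Fintype.card_congr ((Tuple.sort p).subtypeEquiv fun i => Iff.rfl)
  rw [h2] at h1
  exact h1.symm

lemma div_le_inclusionProb_iff {ι : Type*} [Fintype ι] {k : ℕ} (P : ι → Fin k → ℝ) (i : ι)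
    (j : Fin k) (a : ℝ) :
    ((j : ℝ) + 1) / k ≤ inclusionProb P (Set.Iic a) i ↔ kthSmallest (P i) j ≤ a := by
  have hk : k ≠ 0 := fun h => by
    subst h
    exact j.elim0
  have hk' : (0 : ℝ) < k := by exact_mod_cast Nat.pos_of_ne_zero hk
  rw [inclusionProb_Iic hk, div_le_div_iff_of_pos_right hk', kthSmallest_le_iff]
  exact_mod_cast Iff.rfl

/-- For a positive threshold `τ` the set counted by `rangeCount` is a sublevel set of a function
`kthSmallest · j`. -/
lemma exists_le_inclusionProb_iff {k : ℕ} (hk : k ≠ 0) {τ : ℝ} (h0 : 0 < τ) (h1 : τ ≤ 1) :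
    ∃ j : Fin k, ∀ {ι : Type} [Fintype ι] (P : ι → Fin k → ℝ) (i : ι) (a : ℝ),
      τ ≤ inclusionProb P (Set.Iic a) i ↔ kthSmallest (P i) j ≤ a := by
  have hk' : (0 : ℝ) < k := by exact_mod_cast Nat.pos_of_ne_zero hk
  have hpos : 0 < ⌈τ * k⌉₊ := Nat.ceil_pos.2 (by positivity)
  have hle : ⌈τ * k⌉₊ ≤ k := Nat.ceil_le.2 (mul_le_of_le_one_left hk'.le h1)
  refine ⟨⟨⌈τ * k⌉₊ - 1, by omega⟩, fun P i a => ?_⟩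
  rw [inclusionProb_Iic hk, le_div_iff₀ hk', kthSmallest_le_iff, ← Nat.ceil_le]
  simp only
  rw [Nat.sub_add_cancel hpos]

lemma rangeCount_subtype {ι : Type*} {k : ℕ} (T : Finset ι) (P : ι → Fin k → ℝ)
    (r : Set ℝ) (τ : ℝ) (f : ι → ℝ) (a : ℝ)
    (h : ∀ i : {i : ι // i ∈ T},
      τ ≤ inclusionProb (fun i : {i : ι // i ∈ T} => P i) r i ↔ f i ≤ a) :
    rangeCount (fun i : {i : ι // i ∈ T} => P i) r τ = lowFrac f T a := by
  classical
  unfold rangeCount lowFrac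
  simp only [h, Fintype.card_coe]
  congr 2
  rw [Set.ncard_eq_toFinset_card', Set.toFinset_ofPred, Finset.card_filter, Finset.card_filter,
    ← Finset.sum_coe_sort T]

lemma rangeCount_eq_lowFrac {ι : Type*} [Fintype ι] {k : ℕ} (P : ι → Fin k → ℝ)
    (r : Set ℝ) (τ : ℝ) (f : ι → ℝ) (a : ℝ) (h : ∀ i, τ ≤ inclusionProb P r i ↔ f i ≤ a) :
    rangeCount P r τ = lowFrac f Finset.univ a := by
  classical
  unfold rangeCount lowFrac
  simp only [h, Finset.card_univ]
  congr 2
  rw [Set.ncard_eq_toFinset_card', Set.toFinset_ofPred]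

lemma lowFrac_zero {ι : Type*} {V : Finset ι} (hV : V.Nonempty) : lowFrac 0 V 0 = 1 := by
  unfold lowFrac
  have : (V.card : ℝ) ≠ 0 := by exact_mod_cast hV.card_pos.ne'
  simp [div_self this]

lemma isRCCoreset_of_lowFrac {n k : ℕ} (hk : k ≠ 0) (P : Fin n → Fin k → ℝ) {ε : ℝ} (hε : 0 < ε)
    {T : Finset (Fin n)} (hT : T.Nonempty)
    (h : ∀ j a, |lowFrac (fun i => kthSmallest (P i) j) Finset.univ a
      - lowFrac (fun i => kthSmallest (P i) j) T a| ≤ ε) :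
    IsRCCoreset ε P oneSidedIntervals T := by
  refine ⟨hT, ?_⟩
  rintro r ⟨a, rfl⟩ τ ⟨hτ0, hτ1⟩
  rcases hτ0.eq_or_lt with rfl | hτ
  · -- at the threshold `0` every point is counted
    rw [rangeCount_eq_lowFrac P _ _ 0 0 fun i => by simp [inclusionProb],
      rangeCount_subtype T P _ _ 0 0 fun i => by simp [inclusionProb],
      lowFrac_zero hT, lowFrac_zero (hT.mono (Finset.subset_univ T))]
    simpa using hε.le
  · obtain ⟨j, hj⟩ := exists_le_inclusionProb_iff hk hτ hτ1
    rw [rangeCount_eq_lowFrac P _ _ (fun i => kthSmallest (P i) j) a fun i => hj P i a,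
      rangeCount_subtype T P _ _ (fun i => kthSmallest (P i) j) a fun i => hj _ i a]
    exact h j a

end Uncertain

theorem mainTheorem6 :
    (∃ C : ℝ, 0 < C ∧
      ∀ (k n : ℕ), 1 ≤ k → 1 ≤ n → ∀ P : Fin n → Fin k → ℝ,
        ∀ ε : ℝ, 0 < ε → ε ≤ 1 →
          ∃ T : Finset (Fin n),
            Uncertain.IsRCCoreset ε P Uncertain.oneSidedIntervals T ∧
            (T.card : ℝ) ≤ max 1 (C * (Real.sqrt k / ε) * Real.log (k / ε))) ∧
    (∀ (k n : ℕ) (P : Fin n → Fin k → ℝ) (i : Fin n) (j : Fin k) (a : ℝ),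
      ((j : ℝ) + 1) / k ≤ Uncertain.inclusionProb P (Set.Iic a) i ↔
        Uncertain.kthSmallest (P i) j ≤ a) := by
  refine ⟨⟨10 ^ 7, by norm_num, fun k n hk hn P ε hε hε1 => ?_⟩,
    fun k n P i j a => Uncertain.div_le_inclusionProb_iff P i j a⟩
  have : Nonempty (Fin k) := ⟨⟨0, hk⟩⟩
  have : Nonempty (Fin n) := ⟨⟨0, hn⟩⟩
  have hk0 : k ≠ 0 := by omega
  rcases le_or_gt 2 (k / ε) with hkε | hkε
  · obtain ⟨T, -, hT, hcard, happ⟩ := Uncertain.exists_common_approximation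
      (fun (j : Fin k) (i : Fin n) => Uncertain.kthSmallest (P i) j) Finset.univ_nonempty hε hε1
      (by simpa using hkε)
    rw [Fintype.card_fin] at hcard
    exact ⟨T, Uncertain.isRCCoreset_of_lowFrac hk0 P hε hT happ, hcard.trans (le_max_right _ _)⟩
  · -- here `k = 1` and `1 / 2 < ε`, so the logarithm may be tiny, but a median suffices
    rw [div_lt_iff₀ hε] at hkε
    have hk1 : k = 1 := by
      have : (k : ℝ) < 2 := by linarith
      have : k < 2 := by exact_mod_cast this
      omega
    subst hk1
    obtain ⟨v, -, hv⟩ := Uncertain.exists_median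
      (fun i : Fin n => Uncertain.kthSmallest (P i) 0) Finset.univ_nonempty
    refine ⟨{v}, Uncertain.isRCCoreset_of_lowFrac hk0 P hε (Finset.singleton_nonempty v) ?_,
      by simp⟩
    intro j a
    rw [Subsingleton.elim j 0]
    push_cast at hkε
    linarith [hv a]
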